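/- Let $q$ be a prime power and let $n\ge 2$ be an integer. For an $\mathbb F_q$-linear subspace $U\subsetneq \mathbb F_{q^n}$, let $G_U$ be the undirected graph with vertex set $\mathbb F_{q^n}$ in which two vertices $a,b$ are adjacent if and only if $a\ne b$ and $ab\in U$, and let $\omega(G_U)$ be its clique number, i.e. the largest number of vertices of a clique in $G_U$. Let $\omega_{q,n}$ be the largest value of $\omega(G_U)$ as $U$ runs over all the proper $\mathbb F_q$-linear subspaces of $\mathbb F_{q^n}$. Then the following hold. 1. $\omega_{2,n}=n+1$ for $n=2,3,4,5$. 2. If $q>2$ or $n\ge 6$, then $\omega_{q,n}=q^{(n-1)/2}+1$ if $n$ is odd, and $\omega_{q,n}=q^{n/2}$ if $n$ is even. -/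

import Mathlib

/-- For a linear subspace `U` of a field extension `L` of `F`, the graph on the vertex set `L` in
which `a` and `b` are adjacent when `a ≠ b` and the product `a * b` lies in `U`. -/
def productGraph {F L : Type*} [Field F] [Field L] [Algebra F L] (U : Submodule F L) :
    SimpleGraph L where
  Adj a b := a ≠ b ∧ a * b ∈ U
  symm := ⟨fun a b h => ⟨h.1.symm, mul_comm a b ▸ h.2⟩⟩
  loopless := ⟨fun _ h => h.1 rfl⟩

/-- The set of clique numbers of the graphs `productGraph U`, as `U` runs over all the proper
`F`-subspaces of `L`. -/
def properCliqueNumbers (F L : Type*) [Field F] [Field L] [Algebra F L] : Set ℕ :=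
  {m | ∃ U : Submodule F L, U ≠ ⊤ ∧ (productGraph U).cliqueNum = m}

/-!
Every proper subspace lies in the kernel of a nonzero functional `φ`, and then `(x, y) ↦ φ (x * y)`
is a nondegenerate symmetric bilinear form on `L` for which a clique is a set of pairwise
orthogonal vectors.

*Upper bound.* Let `k` members of a clique be anisotropic, and let `W`, of dimension `w`, be spanned
by the others. Then `W` is totally isotropic and orthogonal to the `k` anisotropic members. Pairing
with these maps `Wᗮ`, of dimension `n - w`, onto `F ^ k` (they form a diagonal system), and `W` is
contained in the kernel; so `2 w + k ≤ n`, and the clique has at most `k + q ^ ((n - k) / 2)`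
elements (`exists_card_le_add_pow`). The rest is arithmetic: this bound is at most its value at
`k = 0` or `k = 1` when `q > 2` or `n ≥ 6` (`two_mul_add_pow_sub_le`), and at most its value at
`k = n` when `q = 2` and `n ≤ 5`.

*Lower bound.* In general, let `θ` be a primitive element and `U` the span of the `θ ^ i` with
`i < n - 1`. The span of the `θ ^ i` with `i < n / 2` is a clique of `q ^ (n / 2)` elements, and if
`n` is odd, then `θ ^ (n / 2)` can be added to it. If `q = 2`, choose `φ` with `φ 1 ≠ 0`, so
that `{1}` is orthonormal; an orthonormal family of `k < n` vectors, `k ≥ 1`, can always be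
replaced by one of `k + 1` vectors
(`exists_orthonormal_card_succ`), so there is one of `n` vectors, and `0` can be added to it.
-/

open Module Polynomial

/-! ### The bilinear form of a functional -/

lemma pairwise_mul_insert {M : Type*} [CommMagma M] {P : M → Prop} {s : Set M} {x : M}
    (hs : s.Pairwise fun a b => P (a * b)) (hx : ∀ a ∈ s, P (x * a)) :
    (insert x s).Pairwise fun a b => P (a * b) :=
  hs.insert fun a ha _ => ⟨hx a ha, mul_comm x a ▸ hx a ha⟩

section Form

variable {F L : Type*} [Field F] [Field L] [Algebra F L]

/-- The symmetric bilinear form `(x, y) ↦ φ (x * y)` attached to a linear functional `φ`. -/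
noncomputable def mulForm (φ : L →ₗ[F] F) : LinearMap.BilinForm F L :=
  (LinearMap.mul F L).compr₂ φ

@[simp]
lemma mulForm_apply (φ : L →ₗ[F] F) (x y : L) : mulForm φ x y = φ (x * y) := rfl

lemma exists_apply_mul_eq {φ : L →ₗ[F] F} (hφ : φ ≠ 0) {u : L} (hu : u ≠ 0) (c : F) :
    ∃ z, φ (u * z) = c := by
  obtain ⟨y, hy⟩ := LinearMap.surjective hφ c
  exact ⟨u⁻¹ * y, by rw [mul_inv_cancel_left₀ hu, hy]⟩

lemma mulForm_nondegenerate {φ : L →ₗ[F] F} (hφ : φ ≠ 0) : (mulForm φ).Nondegenerate := by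
  have key : ∀ u : L, (∀ z, φ (u * z) = 0) → u = 0 := by
    intro u hu
    by_contra h
    obtain ⟨z, hz⟩ := exists_apply_mul_eq hφ h 1
    exact one_ne_zero (hz.symm.trans (hu z))
  exact ⟨fun u hu => key u hu, fun u hu => key u fun z => by rw [mul_comm]; exact hu z⟩

/-- The functionals `x ↦ φ (x * a)`, for `a` in the finite set `t`, as one linear map. -/
noncomputable def pairing (φ : L →ₗ[F] F) (t : Finset L) : L →ₗ[F] (t → F) :=
  LinearMap.pi fun a => (mulForm φ).flip a

@[simp]
lemma pairing_apply (φ : L →ₗ[F] F) (t : Finset L) (x : L) (a : t) :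
    pairing φ t x a = φ (x * a) := rfl

end Form

/-! ### The upper bound -/

section Upper

variable {F L : Type*} [Field F] [Field L] [Algebra F L]

/-- If `W` is totally isotropic and orthogonal to a set `t` of pairwise orthogonal anisotropic
vectors, then `2 dim W + |t| ≤ dim L`. -/
lemma two_mul_finrank_add_card_le [FiniteDimensional F L] {φ : L →ₗ[F] F} (hφ : φ ≠ 0)
    {W : Submodule F L} {t : Finset L} (hW : ∀ x ∈ W, ∀ y ∈ W, φ (x * y) = 0)
    (hWt : ∀ x ∈ W, ∀ a ∈ t, φ (x * a) = 0)
    (ht : (t : Set L).Pairwise fun a b => φ (a * b) = 0) (hta : ∀ a ∈ t, φ (a * a) ≠ 0) :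
    2 * finrank F W + t.card ≤ finrank F L := by
  classical
  set O := (mulForm φ).orthogonal W with hO
  have hdimO : finrank F O = finrank F L - finrank F W :=
    LinearMap.BilinForm.finrank_orthogonal (mulForm_nondegenerate hφ) W
  have hWle : finrank F W ≤ finrank F L := W.finrank_le
  have htO : ∀ a ∈ t, a ∈ O := fun a ha x hx => hWt x hx a ha
  have hWO : W ≤ O := fun y hy x hx => hW x hx y hy
  set f := (pairing φ t).domRestrict O with hf
  have hsurj : Function.Surjective f := by
    intro c
    refine ⟨∑ a : t, (c a * (φ (a * a))⁻¹) • (⟨a, htO a a.2⟩ : O), ?_⟩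
    ext b
    have : f (∑ a : t, (c a * (φ (a * a))⁻¹) • (⟨a, htO a a.2⟩ : O)) b
        = ∑ a : t, (c a * (φ (a * a))⁻¹) * φ (a * b) := by
      rw [map_sum, Finset.sum_apply]
      refine Finset.sum_congr rfl fun a _ => ?_
      rw [map_smul]
      rfl
    rw [this, Finset.sum_eq_single b]
    · rw [mul_assoc, inv_mul_cancel₀ (hta b b.2), mul_one]
    · intro a _ hab
      rw [ht a.2 b.2 (fun h => hab (Subtype.ext h)), mul_zero]
    · simp
  have hrk := f.finrank_range_add_finrank_ker
  rw [LinearMap.range_eq_top.2 hsurj, finrank_top, finrank_fintype_fun_eq_card,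
    Fintype.card_coe] at hrk
  have hker : finrank F W ≤ finrank F (LinearMap.ker f) := by
    rw [← (Submodule.comapSubtypeEquivOfLe hWO).finrank_eq]
    refine Submodule.finrank_mono fun x hx => ?_
    rw [LinearMap.mem_ker]
    ext a
    exact hWt x hx a a.2
  omega

/-- A clique of which `k` members are anisotropic has at most `k + q ^ ((n - k) / 2)` elements. -/
lemma exists_card_le_add_pow [Finite F] [FiniteDimensional F L] {φ : L →ₗ[F] F} (hφ : φ ≠ 0)
    {s : Finset L} (hs : (s : Set L).Pairwise fun a b => φ (a * b) = 0) :
    ∃ k ≤ finrank F L, s.card ≤ k + Nat.card F ^ ((finrank F L - k) / 2) := by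
  classical
  have hfin : Finite L := Module.finite_of_finite F
  set t := s.filter fun a => φ (a * a) ≠ 0 with ht
  set r := s.filter fun a => ¬ φ (a * a) ≠ 0 with hr
  set W := Submodule.span F (r : Set L) with hWdef
  have hmem_r : ∀ a ∈ r, a ∈ s ∧ φ (a * a) = 0 := by
    intro a ha
    simpa [hr] using ha
  have hmem_t : ∀ a ∈ t, a ∈ s ∧ φ (a * a) ≠ 0 := by
    intro a ha
    simpa [ht] using ha
  -- A vector orthogonal to all of `r` is orthogonal to `W`.
  have hspan : ∀ y, (∀ a ∈ r, φ (a * y) = 0) → ∀ x ∈ W, φ (x * y) = 0 := by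
    intro y hy x hx
    have hle : W ≤ LinearMap.ker ((mulForm φ).flip y) :=
      Submodule.span_le.2 fun a ha => hy a ha
    exact hle hx
  have hrs : ∀ b ∈ s, (φ (b * b) = 0 ∨ b ∉ r) → ∀ a ∈ r, φ (a * b) = 0 := by
    intro b hb hbb a ha
    by_cases hab : a = b
    · subst hab
      exact (hmem_r a ha).2
    · exact hs (hmem_r a ha).1 hb hab
  have hWr : ∀ x ∈ W, ∀ b ∈ r, φ (x * b) = 0 := fun x hx b hb =>
    hspan b (hrs b (hmem_r b hb).1 (Or.inl (hmem_r b hb).2)) x hx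
  have hWt : ∀ x ∈ W, ∀ b ∈ t, φ (x * b) = 0 := fun x hx b hb =>
    hspan b (hrs b (hmem_t b hb).1 (Or.inr fun h => (hmem_t b hb).2 (hmem_r b h).2)) x hx
  have hWW : ∀ x ∈ W, ∀ y ∈ W, φ (x * y) = 0 := fun x hx y hy =>
    hspan y (fun a ha => by rw [mul_comm]; exact hWr y hy a ha) x hx
  have hdim := two_mul_finrank_add_card_le hφ hWW hWt
    (hs.mono fun a ha => (hmem_t a ha).1) fun a ha => (hmem_t a ha).2
  have hrcard : r.card ≤ Nat.card F ^ finrank F W := by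
    rw [← Module.natCard_eq_pow_finrank (K := F) (V := W), ← Nat.card_eq_finsetCard r]
    exact Nat.card_mono (Set.toFinite _) Submodule.subset_span
  refine ⟨t.card, by omega, ?_⟩
  rw [← Finset.card_filter_add_card_filter_not (s := s) (fun a => φ (a * a) ≠ 0)]
  refine Nat.add_le_add_left (hrcard.trans (Nat.pow_le_pow_right Nat.card_pos ?_)) _
  omega

end Upper

/-! ### Numerical estimates -/

lemma one_add_two_mul_le_pow {q : ℕ} (hq : 3 ≤ q) (j : ℕ) : 1 + 2 * j ≤ q ^ j := by
  refine le_trans ?_ (Nat.pow_le_pow_left hq j)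
  induction j with
  | zero => simp
  | succ j ih => rw [pow_succ]; omega

lemma two_mul_add_one_le_two_pow {m : ℕ} (hm : 3 ≤ m) : 2 * m + 1 ≤ 2 ^ m := by
  induction m, hm using Nat.le_induction with
  | base => norm_num
  | succ m _ ih => rw [pow_succ]; omega

lemma two_mul_add_pow_sub_le {q m j : ℕ} (hq : 2 ≤ q) (h : 2 < q ∨ 3 ≤ m) (hj : j ≤ m) :
    2 * j + q ^ (m - j) ≤ q ^ m := by
  obtain ⟨i, rfl⟩ := Nat.exists_eq_add_of_le hj
  rw [Nat.add_sub_cancel_left, pow_add]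
  have hi : 1 ≤ q ^ i := Nat.one_le_pow _ _ (by omega)
  rcases Nat.lt_or_ge 2 q with h3 | h2
  · have := one_add_two_mul_le_pow h3 j
    nlinarith
  · obtain rfl : q = 2 := by omega
    rcases Nat.eq_zero_or_pos i with rfl | hi0
    · have := two_mul_add_one_le_two_pow (m := j) (by omega)
      simpa using this
    · have h1 : j + 1 ≤ 2 ^ j := Nat.lt_two_pow_self
      have h2 : 2 ≤ 2 ^ i := by simpa using Nat.pow_le_pow_right (n := 2) (by norm_num) hi0
      nlinarith

lemma add_pow_le_of_even {q n k : ℕ} (hq : 2 ≤ q) (h : 2 < q ∨ 6 ≤ n) (hn : Even n) (hk : k ≤ n) :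
    k + q ^ ((n - k) / 2) ≤ q ^ (n / 2) := by
  have := two_mul_add_pow_sub_le (m := n / 2) (j := (k + 1) / 2) hq (by omega)
    (by obtain ⟨r, rfl⟩ := hn; omega)
  have e : (n - k) / 2 = n / 2 - (k + 1) / 2 := by
    obtain ⟨r, rfl⟩ := hn
    omega
  rw [e]
  omega

lemma add_pow_le_of_odd {q n k : ℕ} (hq : 2 ≤ q) (h : 2 < q ∨ 6 ≤ n) (hn : Odd n) (hk : k ≤ n) :
    k + q ^ ((n - k) / 2) ≤ q ^ ((n - 1) / 2) + 1 := by
  obtain ⟨r, rfl⟩ := hn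
  have := two_mul_add_pow_sub_le (m := r) (j := k / 2) hq (by omega) (by omega)
  have e : (2 * r + 1 - k) / 2 = r - k / 2 := by omega
  have e' : (2 * r + 1 - 1) / 2 = r := by omega
  rw [e, e']
  omega

lemma add_two_pow_le {n k : ℕ} (hn : n ≤ 5) (hk : k ≤ n) : k + 2 ^ ((n - k) / 2) ≤ n + 1 := by
  obtain ⟨d, rfl⟩ := Nat.exists_eq_add_of_le hk
  have hd : d ≤ 5 := by omega
  rw [Nat.add_sub_cancel_left]
  interval_cases d <;> norm_num

/-! ### Cliques spanned by powers of a primitive element -/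

section Powers

variable {F L : Type*} [Field F] [Field L] [Algebra F L]

/-- The span of `1, θ, …, θ ^ (d - 1)`: the values at `θ` of the polynomials of degree `< d`. -/
noncomputable def powSpan (F : Type*) {L : Type*} [Field F] [Field L] [Algebra F L] (θ : L)
    (d : ℕ) : Submodule F L :=
  (degreeLT F d).map (aeval θ).toLinearMap

lemma pow_mem_powSpan (θ : L) {i d : ℕ} (h : i < d) : θ ^ i ∈ powSpan F θ d := by
  refine ⟨X ^ i, ?_, by simp⟩
  rw [SetLike.mem_coe, mem_degreeLT, degree_X_pow]
  exact_mod_cast h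

lemma powSpan_mono (θ : L) {d e : ℕ} (h : d ≤ e) : powSpan F θ d ≤ powSpan F θ e :=
  Submodule.map_mono (degreeLT_mono h)

lemma mul_mem_powSpan {θ x y : L} {d e : ℕ} (hx : x ∈ powSpan F θ d)
    (hy : y ∈ powSpan F θ e) : x * y ∈ powSpan F θ (d + e - 1) := by
  obtain ⟨p, hp, rfl⟩ := hx
  obtain ⟨r, hr, rfl⟩ := hy
  refine ⟨p * r, ?_, by simp⟩
  rw [SetLike.mem_coe, mem_degreeLT] at *
  by_cases hp0 : p = 0
  · simp [hp0]
  by_cases hr0 : r = 0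
  · simp [hr0]
  rw [← natDegree_lt_iff_degree_lt (mul_ne_zero hp0 hr0), natDegree_mul hp0 hr0]
  rw [← natDegree_lt_iff_degree_lt hp0] at hp
  rw [← natDegree_lt_iff_degree_lt hr0] at hr
  omega

lemma finrank_powSpan {θ : L} {d : ℕ} (hd : d ≤ (minpoly F θ).natDegree) :
    finrank F (powSpan F θ d) = d := by
  have hinj : Function.Injective ((aeval θ).toLinearMap.domRestrict (degreeLT F d)) := by
    rw [injective_iff_map_eq_zero]
    rintro ⟨p, hp⟩ h
    rw [Subtype.ext_iff]
    by_contra hp0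
    have h1 := minpoly.degree_le_of_ne_zero F θ hp0 h
    rw [mem_degreeLT, ← natDegree_lt_iff_degree_lt hp0] at hp
    have h2 := natDegree_le_natDegree h1
    exact absurd (hp.trans_le (hd.trans h2)) (lt_irrefl _)
  have h := (LinearEquiv.ofInjective _ hinj).finrank_eq
  rw [LinearMap.range_domRestrict] at h
  rw [powSpan, ← h, (degreeLTEquiv F d).finrank_eq, finrank_fin_fun]

/-- Membership would give a monic polynomial of degree `d` that vanishes at `θ`. -/
lemma pow_notMem_powSpan {θ : L} {d : ℕ} (hd : d < (minpoly F θ).natDegree) :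
    θ ^ d ∉ powSpan F θ d := by
  rintro ⟨p, hp, h⟩
  rw [SetLike.mem_coe, mem_degreeLT] at hp
  have hmonic : (X ^ d - p).Monic := monic_X_pow_sub hp
  have h0 : aeval θ (X ^ d - p) = 0 := by
    have h' : aeval θ p = θ ^ d := h
    simp [h']
  have h1 := natDegree_le_natDegree (minpoly.degree_le_of_ne_zero F θ hmonic.ne_zero h0)
  have h2 : (X ^ d - p).natDegree ≤ d := by
    refine natDegree_le_of_degree_le ((degree_sub_le _ _).trans (max_le ?_ hp.le))
    rw [degree_X_pow]
  omega

end Powers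

/-! ### Orthonormal families over the field with two elements -/

section Two

variable {F L : Type*} [Field F] [Field L] [Algebra F L]

/-- Over a field in which every nonzero element is `1`, a nonempty orthonormal family that does not
span can be traded for one with one more member: add an anisotropic vector of the orthogonal
complement if there is one; otherwise replace a member `v` by `v + u` and `v + w`, where `u` and `w`
are isotropic vectors of the complement with `φ (u * w) = 1`. -/
lemma exists_orthonormal_card_succ [FiniteDimensional F L] (hF : ∀ x : F, x ≠ 0 → x = 1)
    (h2 : (1 + 1 : F) = 0) {φ : L →ₗ[F] F} (hφ : φ ≠ 0) {t : Finset L} (hne : t.Nonempty)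
    (ht : (t : Set L).Pairwise fun a b => φ (a * b) = 0) (hta : ∀ a ∈ t, φ (a * a) = 1)
    (hcard : t.card < finrank F L) :
    ∃ t' : Finset L, t'.card = t.card + 1 ∧
      ((t' : Set L).Pairwise fun a b => φ (a * b) = 0) ∧ ∀ a ∈ t', φ (a * a) = 1 := by
  classical
  have hker : LinearMap.ker (pairing φ t) ≠ ⊥ :=
    LinearMap.ker_ne_bot_of_finrank_lt (by simpa using hcard)
  have hmem : ∀ x, x ∈ LinearMap.ker (pairing φ t) ↔ ∀ a ∈ t, φ (x * a) = 0 := by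
    intro x
    rw [LinearMap.mem_ker]
    refine ⟨fun h a ha => congrFun h ⟨a, ha⟩, fun h => ?_⟩
    ext a
    exact h a a.2
  by_cases haniso : ∃ x ∈ LinearMap.ker (pairing φ t), φ (x * x) ≠ 0
  · obtain ⟨x, hx, hxx⟩ := haniso
    rw [hmem] at hx
    have hxt : x ∉ t := fun h => hxx (hx x h)
    refine ⟨insert x t, Finset.card_insert_of_notMem hxt, ?_, ?_⟩
    · rw [Finset.coe_insert]
      exact pairwise_mul_insert (P := fun c => φ c = 0) ht hx
    · intro a ha
      rcases Finset.mem_insert.1 ha with rfl | ha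
      · exact hF _ hxx
      · exact hta a ha
  · push Not at haniso
    obtain ⟨u, hu, hu0⟩ := Submodule.exists_mem_ne_zero_of_ne_bot hker
    obtain ⟨z, hz⟩ := exists_apply_mul_eq hφ hu0 1
    -- The component of `z` orthogonal to the family.
    set w := z - ∑ a ∈ t, φ (z * a) • a with hw
    have hwφ : ∀ b, φ (w * b) = φ (z * b) - ∑ a ∈ t, φ (z * a) * φ (a * b) := by
      intro b
      simp [hw, sub_mul, Finset.sum_mul, map_sum]
    have hwker : w ∈ LinearMap.ker (pairing φ t) := by
      rw [hmem]
      intro b hb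
      rw [hwφ, Finset.sum_eq_single_of_mem b hb fun a ha hab => by rw [ht ha hb hab, mul_zero],
        hta b hb, mul_one, sub_self]
    have huu := haniso u hu
    have hww := haniso w hwker
    rw [hmem] at hu hwker
    have hwu : φ (w * u) = 1 := by
      rw [hwφ, Finset.sum_eq_zero fun a ha => by rw [mul_comm a u, hu a ha, mul_zero], sub_zero,
        mul_comm, hz]
    obtain ⟨v, hv⟩ := hne
    have hvv := hta v hv
    have huv := hu v hv
    have hwv := hwker v hv
    have hvu : φ (v * u) = 0 := by rwa [mul_comm]
    have hvw : φ (v * w) = 0 := by rwa [mul_comm]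
    have huw : φ (u * w) = 1 := by rwa [mul_comm]
    have e1 : φ ((v + u) * (v + u)) = 1 := by simp [add_mul, mul_add, *]
    have e2 : φ ((v + w) * (v + w)) = 1 := by simp [add_mul, mul_add, hvv, hvw, hwv, hww]
    have e3 : φ ((v + u) * (v + w)) = 0 := by
      simp [add_mul, mul_add, hvv, hvw, huv, huw, h2]
    have ou : ∀ a ∈ t.erase v, φ ((v + u) * a) = 0 := by
      intro a ha
      rw [add_mul, map_add, hu a (Finset.mem_of_mem_erase ha),
        ht hv (Finset.mem_of_mem_erase ha) (Finset.ne_of_mem_erase ha).symm, add_zero]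
    have ow : ∀ a ∈ t.erase v, φ ((v + w) * a) = 0 := by
      intro a ha
      rw [add_mul, map_add, hwker a (Finset.mem_of_mem_erase ha),
        ht hv (Finset.mem_of_mem_erase ha) (Finset.ne_of_mem_erase ha).symm, add_zero]
    have n1 : v + w ∉ t.erase v := fun h => one_ne_zero (e2.symm.trans (ow _ h))
    have n2 : v + u ∉ insert (v + w) (t.erase v) := by
      intro h
      rcases Finset.mem_insert.1 h with h | h
      · rw [← h] at e3
        exact one_ne_zero (e1.symm.trans e3)
      · exact one_ne_zero (e1.symm.trans (ou _ h))
    refine ⟨insert (v + u) (insert (v + w) (t.erase v)), ?_, ?_, ?_⟩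
    · rw [Finset.card_insert_of_notMem n2, Finset.card_insert_of_notMem n1,
        Finset.card_erase_add_one hv]
    · rw [Finset.coe_insert, Finset.coe_insert]
      refine pairwise_mul_insert (P := fun c => φ c = 0)
        (pairwise_mul_insert (P := fun c => φ c = 0) ?_ ow) ?_
      · exact ht.mono fun a ha => Finset.mem_of_mem_erase ha
      · rintro a (rfl | ha)
        · exact e3
        · exact ou a ha
    · intro a ha
      rcases Finset.mem_insert.1 ha with rfl | ha
      · exact e1
      rcases Finset.mem_insert.1 ha with rfl | ha
      · exact e2
      · exact hta a (Finset.mem_of_mem_erase ha)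

lemma exists_orthonormal_card_eq_finrank [FiniteDimensional F L] (hF : ∀ x : F, x ≠ 0 → x = 1)
    (h2 : (1 + 1 : F) = 0) {φ : L →ₗ[F] F} (hφ : φ 1 ≠ 0) :
    ∃ t : Finset L, t.card = finrank F L ∧
      ((t : Set L).Pairwise fun a b => φ (a * b) = 0) ∧ ∀ a ∈ t, φ (a * a) = 1 := by
  have hφ0 : φ ≠ 0 := by
    rintro rfl
    exact hφ rfl
  have key : ∀ k, 1 ≤ k → k ≤ finrank F L → ∃ t : Finset L, t.card = k ∧
      ((t : Set L).Pairwise fun a b => φ (a * b) = 0) ∧ ∀ a ∈ t, φ (a * a) = 1 := by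
    intro k hk
    induction k, hk using Nat.le_induction with
    | base =>
      intro _
      refine ⟨{1}, rfl, by simp, ?_⟩
      intro a ha
      rw [Finset.mem_singleton.1 ha, mul_one]
      exact hF _ hφ
    | succ k hk ih =>
      intro hkn
      obtain ⟨t, hc, ht, hta⟩ := ih (by omega)
      obtain ⟨t', hc', h'⟩ := exists_orthonormal_card_succ hF h2 hφ0
        (Finset.card_pos.1 (by omega)) ht hta (by omega)
      exact ⟨t', by omega, h'⟩
  exact key _ finrank_pos le_rfl

end Two

/-! ### The clique numbers -/

section Clique

variable {F L : Type*} [Field F] [Field L] [Algebra F L]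

lemma isClique_productGraph_iff {U : Submodule F L} {s : Set L} :
    (productGraph U).IsClique s ↔ s.Pairwise fun a b => a * b ∈ U :=
  ⟨fun h _ ha _ hb hab => (h ha hb hab).2, fun h _ ha _ hb hab => ⟨hab, h ha hb hab⟩⟩

/-- To find the largest clique number it is enough to bound `k + q ^ ((n - k) / 2)` and to exhibit
one clique that attains the bound. -/
lemma isGreatest_properCliqueNumbers [Finite F] [FiniteDimensional F L] {M : ℕ}
    (hM : ∀ k ≤ finrank F L, k + Nat.card F ^ ((finrank F L - k) / 2) ≤ M)
    {U : Submodule F L} (hU : U ≠ ⊤) {s : Finset L}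
    (hs : (s : Set L).Pairwise fun a b => a * b ∈ U) (hcard : s.card = M) :
    IsGreatest (properCliqueNumbers F L) M := by
  have hfin : Finite L := Module.finite_of_finite F
  have hub : ∀ V : Submodule F L, V ≠ ⊤ → (productGraph V).cliqueNum ≤ M := by
    intro V hV
    obtain ⟨φ, hφ, hle⟩ := Submodule.exists_le_ker_of_lt_top V hV.lt_top
    obtain ⟨c, hc⟩ := (productGraph V).exists_isNClique_cliqueNum
    obtain ⟨k, hk, h⟩ := exists_card_le_add_pow hφ (s := c)
      fun a ha b hb hab => hle (isClique_productGraph_iff.1 hc.isClique ha hb hab)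
    rw [← hc.card_eq]
    exact h.trans (hM k hk)
  refine ⟨⟨U, hU, (hub U hU).antisymm ?_⟩, ?_⟩
  · rw [← hcard]
    exact SimpleGraph.IsClique.card_le_cliqueNum (tc := isClique_productGraph_iff.2 hs)
  · rintro _ ⟨V, hV, rfl⟩
    exact hub V hV

/-- The two cliques of powers of a primitive element, for one and the same subspace. -/
lemma exists_clique_card_eq_pow [Finite F] [FiniteDimensional F L] (hn : 2 ≤ finrank F L) :
    ∃ U : Submodule F L, U ≠ ⊤ ∧
      (∃ s : Finset L, ((s : Set L).Pairwise fun a b => a * b ∈ U) ∧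
        s.card = Nat.card F ^ (finrank F L / 2)) ∧
      (Odd (finrank F L) → ∃ s : Finset L, ((s : Set L).Pairwise fun a b => a * b ∈ U) ∧
        s.card = Nat.card F ^ ((finrank F L - 1) / 2) + 1) := by
  classical
  have hfin : Finite L := Module.finite_of_finite F
  obtain ⟨θ, hθ⟩ := Field.exists_primitive_element_of_finite_bot F L
  have hdeg : (minpoly F θ).natDegree = finrank F L :=
    (Field.primitive_element_iff_minpoly_natDegree_eq F θ).1 hθ
  set n := finrank F L with hndef
  set s : Finset L := (Set.toFinite (powSpan F θ (n / 2) : Set L)).toFinset with hsdef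
  have hmem : ∀ x, x ∈ s ↔ x ∈ powSpan F θ (n / 2) := by simp [hsdef]
  have hcard : s.card = Nat.card F ^ (n / 2) := by
    have h1 : Nat.card (powSpan F θ (n / 2)) = s.card :=
      Nat.card_eq_card_finite_toFinset (Set.toFinite (powSpan F θ (n / 2) : Set L))
    rw [← h1, Module.natCard_eq_pow_finrank (K := F), finrank_powSpan (by omega)]
  have hmul : (s : Set L).Pairwise fun a b => a * b ∈ powSpan F θ (n - 1) := by
    intro a ha b hb _
    exact powSpan_mono θ (by omega) (mul_mem_powSpan ((hmem a).1 ha) ((hmem b).1 hb))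
  refine ⟨powSpan F θ (n - 1), ?_, ⟨s, hmul, hcard⟩, fun hodd => ?_⟩
  · intro h
    have h1 := finrank_powSpan (F := F) (θ := θ) (d := n - 1) (by omega)
    rw [h, finrank_top] at h1
    omega
  · have hodd2 : n = 2 * (n / 2) + 1 := (Nat.two_mul_div_two_add_one_of_odd hodd).symm
    have hnot : θ ^ (n / 2) ∉ s := by
      rw [hmem]
      exact pow_notMem_powSpan (by omega)
    refine ⟨insert (θ ^ (n / 2)) s, ?_, ?_⟩
    · rw [Finset.coe_insert]
      refine pairwise_mul_insert (P := (· ∈ powSpan F θ (n - 1))) hmul fun a ha => ?_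
      exact powSpan_mono θ (by omega)
        (mul_mem_powSpan (pow_mem_powSpan θ (Nat.lt_succ_self _)) ((hmem a).1 ha))
    · rw [Finset.card_insert_of_notMem hnot, hcard, show (n - 1) / 2 = n / 2 by omega]

lemma exists_clique_of_card_eq_two [Finite F] [FiniteDimensional F L] (hF : Nat.card F = 2) :
    ∃ U : Submodule F L, U ≠ ⊤ ∧ ∃ s : Finset L,
      ((s : Set L).Pairwise fun a b => a * b ∈ U) ∧ s.card = finrank F L + 1 := by
  classical
  have hone : ∀ x : F, x ≠ 0 → x = 1 := by
    intro x hx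
    have := Fintype.ofFinite F
    have h := FiniteField.pow_card_sub_one_eq_one x hx
    rw [← Nat.card_eq_fintype_card, hF] at h
    simpa using h
  have h2 : (1 + 1 : F) = 0 := by
    by_contra h
    exact one_ne_zero (add_eq_left.1 (hone _ h))
  obtain ⟨φ, hφ⟩ : ∃ φ : L →ₗ[F] F, φ 1 ≠ 0 := by
    by_contra! h
    exact one_ne_zero ((Module.forall_dual_apply_eq_zero_iff F (1 : L)).1 h)
  obtain ⟨t, hc, ht, hta⟩ := exists_orthonormal_card_eq_finrank hone h2 hφ
  have h0 : (0 : L) ∉ t := by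
    intro h
    have := hta 0 h
    simp at this
  refine ⟨LinearMap.ker φ, ?_, insert 0 t, ?_, ?_⟩
  · intro h
    exact hφ (LinearMap.mem_ker.1 (h ▸ Submodule.mem_top))
  · rw [Finset.coe_insert]
    exact pairwise_mul_insert (P := (· ∈ LinearMap.ker φ)) ht fun a _ => by simp
  · rw [Finset.card_insert_of_notMem h0, hc]

end Clique

theorem mainTheorem2 {F L : Type*} [Field F] [Finite F] [Field L] [Algebra F L] (q n : ℕ)
    (hq : Nat.card F = q) (hn : 2 ≤ n) (hL : Module.finrank F L = n) :
    (q = 2 → n ≤ 5 → IsGreatest (properCliqueNumbers F L) (n + 1)) ∧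
    (2 < q ∨ 6 ≤ n →
      (Odd n → IsGreatest (properCliqueNumbers F L) (q ^ ((n - 1) / 2) + 1)) ∧
      (Even n → IsGreatest (properCliqueNumbers F L) (q ^ (n / 2)))) := by
  have hfd : FiniteDimensional F L := Module.finite_of_finrank_pos (by omega)
  subst hq hL
  have hq2 : 2 ≤ Nat.card F := Finite.one_lt_card
  refine ⟨fun h2 h5 => ?_, fun h => ⟨fun ho => ?_, fun he => ?_⟩⟩
  · obtain ⟨U, hU, s, hs, hc⟩ := exists_clique_of_card_eq_two (F := F) (L := L) h2
    refine isGreatest_properCliqueNumbers (fun k hk => ?_) hU hs hc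
    rw [h2]
    exact add_two_pow_le h5 hk
  · obtain ⟨U, hU, -, hodd⟩ := exists_clique_card_eq_pow (F := F) (L := L) hn
    obtain ⟨s, hs, hc⟩ := hodd ho
    exact isGreatest_properCliqueNumbers (fun k hk => add_pow_le_of_odd hq2 h ho hk) hU hs hc
  · obtain ⟨U, hU, ⟨s, hs, hc⟩, -⟩ := exists_clique_card_eq_pow (F := F) (L := L) hn
    exact isGreatest_properCliqueNumbers (fun k hk => add_pow_le_of_even hq2 h he hk) hU hs hc
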